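/- Let $d\ge 1$ and let $\mathbb P_\xi$ be a probability measure on $\mathbb R^d$ such that $\int |x|_2\,\mathbb P_\xi(\mathrm dx)<\infty$, $\mathbb P_\xi$ has a density $f_\xi$ with respect to Lebesgue measure, and its characteristic function $t\mapsto \int e^{i\langle t,x\rangle}\,\mathbb P_\xi(\mathrm dx)$ has no zero $t\in\mathbb R^d$. Call a pair $(X,Y)$ of $\mathbb R^d$-valued random vectors on a common probability space a martingale pair if $X$ and $Y$ are integrable and $\mathbb E[Y\mid X]=X$ almost surely. Then $\mathbb P_\xi$ is martingality-preserving: for every probability measure $\mathbb P$ on $\mathbb R^d\times\mathbb R^d$ and all random vectors $X,Y,\xi$ on a common probability space such that $((X,Y),\xi)$ has law $\mathbb P\otimes\mathbb P_\xi$, $$(X,Y)\text{ is a martingale pair}\quad\Longleftrightarrow\quad (X+\xi,Y+\xi)\text{ is a martingale pair}.$$ In particular, if $(X,Y)$ is integrable and independent of $\xi\sim\mathbb P_\xi$, then $\mathbb E[Y\mid X]=X$ a.s. if and only if $\mathbb E[Y+\xi\mid X+\xi]=X+\xi$ a.s. -/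

import Mathlib

open MeasureTheory

universe u

/-- `(X, Y)` is a martingale pair under `μ`: both random vectors are integrable and
`𝔼[Y | X] = X` almost surely, where conditioning on `X` means conditioning on the
`σ`-algebra generated by `X`. It is used for measurable `X` and `Y`. -/
def IsMartingalePair {Ω : Type u} [MeasurableSpace Ω] {d : ℕ}
    (X Y : Ω → EuclideanSpace ℝ (Fin d)) (μ : Measure Ω) : Prop :=
  Integrable X μ ∧ Integrable Y μ ∧
    μ[Y | MeasurableSpace.comap X inferInstance] =ᵐ[μ] X

/-- A law `Pξ` on `ℝᵈ` is martingality-preserving if for every law `P` on `ℝᵈ × ℝᵈ` and all random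
vectors `X, Y, ξ` on some probability space with `((X, Y), ξ) ∼ P ⊗ Pξ`, the pair `(X, Y)` is a
martingale if and only if the pair `(X + ξ, Y + ξ)` is a martingale. -/
def IsMartingalityPreserving {d : ℕ} (Pξ : Measure (EuclideanSpace ℝ (Fin d))) : Prop :=
  ∀ (P : Measure (EuclideanSpace ℝ (Fin d) × EuclideanSpace ℝ (Fin d))), IsProbabilityMeasure P →
    ∀ (Ω : Type u) [MeasurableSpace Ω] (μ : Measure Ω) [IsProbabilityMeasure μ]
      (X Y ξ : Ω → EuclideanSpace ℝ (Fin d)),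
      Measurable X → Measurable Y → Measurable ξ →
      μ.map (fun ω => ((X ω, Y ω), ξ ω)) = P.prod Pξ →
      (IsMartingalePair X Y μ ↔
        IsMartingalePair (fun ω => X ω + ξ ω) (fun ω => Y ω + ξ ω) μ)

/-! Put `Z = Y - X`, which does not change when `ξ` is added to both vectors. For integrable pairs
the martingale property says `𝔼[Z | X] = 0`, i.e. the vector measure `A ↦ 𝔼[Z; X ∈ A]` is zero. By
Fourier uniqueness this means `𝔼[⟨v, Z⟩ exp(i⟨X, t⟩)] = 0` for all `v, t`
(`condExp_comap_ae_eq_zero_iff`). Replacing `X` by `X + ξ` multiplies this transform by `charFun Pξ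
t` (`integral_smul_exp_inner_add`), which never vanishes, so both transforms vanish together. -/

section ConditionalExpectation

variable {Ω : Type*} [MeasurableSpace Ω] {μ : Measure Ω}

/-- Integrals against the push-forwards of the positive and the negative part of the signed
measure `f • μ` differ by the integral against `f`. -/
theorem integral_map_withDensity_ofReal_sub {E F : Type*} [MeasurableSpace E]
    [NormedAddCommGroup F] [NormedSpace ℝ F] [SecondCountableTopology F]
    [MeasurableSpace F] [BorelSpace F] {X : Ω → E} (hX : Measurable X) {f : Ω → ℝ}
    (hf : Measurable f) (hfi : Integrable f μ) {g : E → F} (hg : Measurable g) {C : ℝ}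
    (hC : ∀ x, ‖g x‖ ≤ C) :
    ∫ x, g x ∂((μ.withDensity fun ω => ENNReal.ofReal (f ω)).map X)
      - ∫ x, g x ∂((μ.withDensity fun ω => ENNReal.ofReal (-f ω)).map X)
      = ∫ ω, f ω • g (X ω) ∂μ := by
  have hgs : StronglyMeasurable g := hg.stronglyMeasurable
  have hgX : AEStronglyMeasurable (fun ω => g (X ω)) μ :=
    (hg.comp hX).stronglyMeasurable.aestronglyMeasurable
  rw [integral_map hX.aemeasurable hgs.aestronglyMeasurable,
    integral_map hX.aemeasurable hgs.aestronglyMeasurable,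
    integral_withDensity_eq_integral_toReal_smul hf.ennreal_ofReal
      (Filter.Eventually.of_forall fun _ => ENNReal.ofReal_lt_top),
    integral_withDensity_eq_integral_toReal_smul (f := fun ω => ENNReal.ofReal (-f ω))
      hf.neg.ennreal_ofReal
      (Filter.Eventually.of_forall fun _ => ENNReal.ofReal_lt_top), ← integral_sub]
  · refine integral_congr_ae (Filter.Eventually.of_forall fun ω => ?_)
    simp only [ENNReal.toReal_ofReal', ← sub_smul]
    rw [max_zero_sub_eq_self]
  · simp only [ENNReal.toReal_ofReal']
    exact hfi.pos_part.smul_bdd C hgX (Filter.Eventually.of_forall fun ω => hC (X ω))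
  · simp only [ENNReal.toReal_ofReal']
    exact hfi.neg_part.smul_bdd C hgX (Filter.Eventually.of_forall fun ω => hC (X ω))

variable {E : Type*} [NormedAddCommGroup E] [InnerProductSpace ℝ E] [SecondCountableTopology E]
  [CompleteSpace E] [MeasurableSpace E] [BorelSpace E]

/-- Splitting `f` into positive and negative parts gives two finite measures `νp`, `νn` on `E`. Both
conditions say `νp = νn`: one on sets, the other through injectivity of the characteristic function
on finite measures. This avoids Fourier analysis of signed measures. -/
theorem forall_setIntegral_preimage_eq_zero_iff {X : Ω → E} (hX : Measurable X) {f : Ω → ℝ}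
    (hf : Measurable f) (hfi : Integrable f μ) :
    (∀ A : Set E, MeasurableSet A → ∫ ω in X ⁻¹' A, f ω ∂μ = 0) ↔
      ∀ t : E, ∫ ω, f ω • Complex.exp (inner ℝ (X ω) t * Complex.I) ∂μ = 0 := by
  set νp := (μ.withDensity fun ω => ENNReal.ofReal (f ω)).map X with hνp
  set νn := (μ.withDensity fun ω => ENNReal.ofReal (-f ω)).map X with hνn
  have : IsFiniteMeasure (μ.withDensity fun ω => ENNReal.ofReal (f ω)) :=
    isFiniteMeasure_withDensity_ofReal hfi.2
  have : IsFiniteMeasure (μ.withDensity fun ω => ENNReal.ofReal (-f ω)) :=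
    isFiniteMeasure_withDensity_ofReal hfi.neg.2
  have : IsFiniteMeasure νp := by rw [hνp]; infer_instance
  have : IsFiniteMeasure νn := by rw [hνn]; infer_instance
  have hset : ∀ A : Set E, MeasurableSet A →
      νp.real A - νn.real A = ∫ ω in X ⁻¹' A, f ω ∂μ := by
    intro A hA
    have h := integral_map_withDensity_ofReal_sub hX hf hfi
      (g := A.indicator (fun _ => (1 : ℝ))) (measurable_const.indicator hA) (C := 1)
      (fun x => (norm_indicator_le_norm_self _ x).trans (by simp))
    rw [← hνp, ← hνn, integral_indicator_const _ hA, integral_indicator_const _ hA] at h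
    rw [← integral_indicator (hX hA)]
    simp only [smul_eq_mul, mul_one] at h
    rw [h]
    refine integral_congr_ae (Filter.Eventually.of_forall fun ω => ?_)
    by_cases hω : X ω ∈ A <;> simp [hω]
  have hchar : ∀ t : E, charFun νp t - charFun νn t =
      ∫ ω, f ω • Complex.exp (inner ℝ (X ω) t * Complex.I) ∂μ := fun t =>
    integral_map_withDensity_ofReal_sub hX hf hfi
      (g := fun x => Complex.exp (inner ℝ x t * Complex.I)) (by fun_prop) (C := 1)
      (fun x => (Complex.norm_exp_ofReal_mul_I _).le)
  have h1 : (∀ A : Set E, MeasurableSet A → ∫ ω in X ⁻¹' A, f ω ∂μ = 0) ↔ νp = νn := by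
    refine ⟨fun h => Measure.ext fun A hA => ?_, fun h A hA => ?_⟩
    · have h' := hset A hA
      rw [h A hA, sub_eq_zero] at h'
      exact (measureReal_eq_measureReal_iff).1 h'
    · rw [← hset A hA, h, sub_self]
  rw [h1]
  refine ⟨fun h t => ?_, fun h => Measure.ext_of_charFun (funext fun t => ?_)⟩
  · rw [← hchar t, h, sub_self]
  · exact sub_eq_zero.1 ((hchar t).trans (h t))

/-- A conditional expectation `𝔼[Z | X]` vanishes iff the Fourier transforms of all the
projections of the vector measure `A ↦ 𝔼[Z; X ∈ A]` do. -/
theorem condExp_comap_ae_eq_zero_iff [IsFiniteMeasure μ] {X Z : Ω → E} (hX : Measurable X)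
    (hZ : Measurable Z) (hZi : Integrable Z μ) :
    μ[Z | MeasurableSpace.comap X inferInstance] =ᵐ[μ] 0 ↔
      ∀ v t : E,
        ∫ ω, (inner ℝ v (Z ω) : ℝ) • Complex.exp (inner ℝ (X ω) t * Complex.I) ∂μ = 0 := by
  have hm := hX.comap_le
  have hv : ∀ v : E, (∀ A : Set E, MeasurableSet A →
      ∫ ω in X ⁻¹' A, (inner ℝ v (Z ω) : ℝ) ∂μ = 0) ↔ _ := fun v =>
    forall_setIntegral_preimage_eq_zero_iff hX (measurable_const.inner hZ) (hZi.const_inner v)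
  simp only [← hv]
  constructor
  · intro h v A hA
    rw [integral_inner hZi.integrableOn, ← setIntegral_condExp hm hZi ⟨A, hA, rfl⟩,
      setIntegral_congr_ae (g := 0) (hm _ ⟨A, hA, rfl⟩) (h.mono fun _ hx _ => hx)]
    simp
  · intro h
    -- By uniqueness of the conditional expectation it suffices that `Z` integrates to zero over
    -- each `X ⁻¹' A`, which is checked on projections.
    refine (ae_eq_condExp_of_forall_setIntegral_eq hm hZi
      (fun _ _ _ => integrableOn_zero) ?_ aestronglyMeasurable_zero).symm
    rintro _ ⟨A, hA, rfl⟩ -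
    rw [integral_eq_zero_of_forall_integral_inner_eq_zero ℝ Z hZi.integrableOn
      fun v => h v A hA]
    simp

theorem condExp_comap_ae_eq_iff [IsFiniteMeasure μ] {X Y : Ω → E} (hX : Measurable X)
    (hXi : Integrable X μ) (hYi : Integrable Y μ) :
    μ[Y | MeasurableSpace.comap X inferInstance] =ᵐ[μ] X ↔
      μ[Y - X | MeasurableSpace.comap X inferInstance] =ᵐ[μ] 0 := by
  have h := condExp_sub hYi hXi (MeasurableSpace.comap X inferInstance)
  rw [condExp_of_stronglyMeasurable hX.comap_le (f := X)
    (comap_measurable X).stronglyMeasurable hXi] at h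
  constructor
  · intro h'
    filter_upwards [h, h'] with ω h1 h2
    simp [h1, h2]
  · intro h'
    filter_upwards [h, h'] with ω h1 h2
    rw [h1] at h2
    exact sub_eq_zero.1 h2

end ConditionalExpectation

/-- The exponential of the sum splits into a factor in `X` and a factor in `ξ`; the product law then
separates the integrals. -/
theorem integral_smul_exp_inner_add {Ω : Type*} [MeasurableSpace Ω] {μ : Measure Ω}
    {E : Type*} [NormedAddCommGroup E] [InnerProductSpace ℝ E] [SecondCountableTopology E]
    [MeasurableSpace E] [BorelSpace E] {P : Measure (E × E)} {Q : Measure E} [SFinite P]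
    [IsProbabilityMeasure Q]
    {X Y ξ : Ω → E} (hX : Measurable X) (hY : Measurable Y) (hξ : Measurable ξ)
    (hlaw : μ.map (fun ω => ((X ω, Y ω), ξ ω)) = P.prod Q) (v t : E) :
    ∫ ω, (inner ℝ v (Y ω - X ω) : ℝ) • Complex.exp (inner ℝ (X ω + ξ ω) t * Complex.I) ∂μ =
      (∫ ω, (inner ℝ v (Y ω - X ω) : ℝ) • Complex.exp (inner ℝ (X ω) t * Complex.I) ∂μ)
        * charFun Q t := by
  have hXY : μ.map (fun ω => (X ω, Y ω)) = P := by
    have h := congrArg (Measure.map Prod.fst) hlaw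
    rw [Measure.map_map measurable_fst (by fun_prop)] at h
    simpa [Function.comp_def] using h
  set G : E × E → ℂ := fun p =>
    (inner ℝ v (p.2 - p.1) : ℝ) • Complex.exp (inner ℝ p.1 t * Complex.I) with hG
  have hGm : StronglyMeasurable G :=
    Measurable.stronglyMeasurable (by fun_prop)
  set H : E → ℂ := fun x => Complex.exp (inner ℝ x t * Complex.I) with hH
  have hHm : Measurable H := by fun_prop
  have h1 : ∫ ω, G (X ω, Y ω) ∂μ = ∫ p, G p ∂P := by
    rw [← hXY, integral_map (by fun_prop) hGm.aestronglyMeasurable]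
  calc _ = ∫ ω, G (X ω, Y ω) * H (ξ ω) ∂μ := by
        refine integral_congr_ae (Filter.Eventually.of_forall fun ω => ?_)
        simp only [hG, hH, inner_add_left, Complex.ofReal_add, add_mul, Complex.exp_add,
          smul_mul_assoc]
    _ = ∫ z, G z.1 * H z.2 ∂(P.prod Q) := by
        rw [← hlaw, integral_map (by fun_prop)]
        exact (Measurable.stronglyMeasurable
          ((hGm.measurable.comp measurable_fst).mul
            (hHm.comp measurable_snd))).aestronglyMeasurable
    _ = (∫ p, G p ∂P) * charFun Q t := integral_prod_mul G H
    _ = _ := by rw [← h1]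

theorem mainTheorem3 {d : ℕ} (Pξ : Measure (EuclideanSpace ℝ (Fin d))) [IsProbabilityMeasure Pξ]
    (hint : Integrable (fun x : EuclideanSpace ℝ (Fin d) => x) Pξ)
    (fξ : EuclideanSpace ℝ (Fin d) → ENNReal) (hfξ : Measurable fξ)
    (hdens : Pξ = (volume : Measure (EuclideanSpace ℝ (Fin d))).withDensity fξ)
    (hchar : ∀ t : EuclideanSpace ℝ (Fin d), charFun Pξ t ≠ 0) :
    IsMartingalityPreserving.{u} Pξ := by
  intro P hP Ω _ μ _ X Y ξ hX hY hξ hlaw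
  have hξi : Integrable ξ μ := by
    have h := congrArg (Measure.map Prod.snd) hlaw
    rw [Measure.map_map measurable_snd (by fun_prop)] at h
    have h' : μ.map ξ = Pξ := by simpa [Function.comp_def] using h
    rw [← h'] at hint
    exact hint.comp_measurable hξ
  have hadd : ∀ W : Ω → EuclideanSpace ℝ (Fin d),
      Integrable (fun ω => W ω + ξ ω) μ ↔ Integrable W μ := fun W =>
    integrable_add_iff_integrable_left hξi
  have hXξ : Measurable fun ω => X ω + ξ ω := hX.add hξ
  have hYξ : Measurable fun ω => Y ω + ξ ω := hY.add hξ
  unfold IsMartingalePair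
  -- Integrability of `ξ` makes the integrability clauses of the two pairs equivalent; only the
  -- conditional expectations remain.
  rw [hadd X, hadd Y]
  refine and_congr_right fun hXi => and_congr_right fun hYi => ?_
  rw [condExp_comap_ae_eq_iff hX hXi hYi,
    condExp_comap_ae_eq_iff hXξ ((hadd X).2 hXi) ((hadd Y).2 hYi),
    condExp_comap_ae_eq_zero_iff hX (hY.sub hX) (hYi.sub hXi),
    condExp_comap_ae_eq_zero_iff hXξ (hYξ.sub hXξ)
      (((hadd Y).2 hYi).sub ((hadd X).2 hXi))]
  -- The equivalence holds for each `v` and `t` separately.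
  refine forall_congr' fun v => forall_congr' fun t => ?_
  simp only [Pi.sub_apply, add_sub_add_right_eq_sub]
  rw [integral_smul_exp_inner_add hX hY hξ hlaw, mul_eq_zero, or_iff_left (hchar t)]
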